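/- **Theorem 1.** Consider a network of $S$ agents on an undirected graph, partitioned into clusters. For $k=1,\dots,S$ and $i=1,2,\dots$ let $\mathbf{x}_k(i)$ be the observation of agent $k$ at time $i$, with values in a finite alphabet $\mathcal{A}=\{1,\dots,M\}$. All the $\mathbf{x}_k(i)$ are mutually independent, and those of the agents of one cluster are identically distributed, with a strictly positive PMF that depends on the cluster and is constant in time. The data vector $\mathbf{d}_k(i)=[\mathbf{d}_k^{(1)}(i),\dots,\mathbf{d}_k^{(R)}(i)]^T$ of agent $k$ is one of the following: - (informed agents) $R=H$ and $\mathbf{d}_k^{(h)}(i)=\log p_h(\mathbf{x}_k(i))$, where $p_1,\dots,p_H$ are strictly positive PMFs on $\mathcal{A}$ and the PMF of the observations of each cluster is one of $p_1,\dots,p_H$; - (partially informed agents) $R=M$ and $\mathbf{d}_k^{(m)}(i)=1$ if $\mathbf{x}_k(i)=m$, $\mathbf{d}_k^{(m)}(i)=0$ otherwise; here either all the observations are drawn from a strictly positive null PMF $p_0$, or those of each cluster are drawn from a strictly positive PMF different from $p_0$. Assume perfect clustering: $A=[a_{k\ell}]$ is a fixed $S\times S$ matrix, nonnegative and right-stochastic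 (its rows sum to one), such that $a_{k\ell}=0$ unless $\ell$ is an effective neighbor of $k$, i.e. $\ell$ belongs to the cluster of $k$ and is either $k$ itself or connected to $k$ by an edge. Let $b_{k\ell}(j)$ be the $(k,\ell)$ entry of $B(j)=A^j$. For a step size $\mu\in(0,1)$, $1\le j\le i$ and $r=1,\dots,R$ put $$\mathbf{t}_k^{(r)}(i,j)=\sqrt{\mu}\,(1-\mu)^{j-1}\sum_{\ell=1}^S b_{k\ell}(j)\,\mathbf{d}_\ell^{(r)}(i-j+1),\qquad \mathbf{q}_k(i,j)=\big[\mathbf{t}_k^{(1)}(i,j),\dots,\mathbf{t}_k^{(R)}(i,j)\big]^T,$$ so that $\mathbf{w}_k(i)=\sqrt{\mu}\sum_{j=1}^i\mathbf{q}_k(i,j)$ is the status of agent $k$ at time $i$ (up to the deterministic contribution of the initial condition, if it is not zero). Then, for every agent $k$: 1. For every $\mu\in(0,1)$ the series $\sum_{j=1}^\infty\sum_{\ell=1}^S\mu(1-\mu)^{2j-2}\,b_{k\ell}(j)^2$ converges; the limit $$\beta_k(A)=\lim_{\mu\to0^+}\sum_{j=1}^\infty\sum_{\ell=1}^S\mu(1-\mu)^{2j-2}\,b_{k\ell}(j)^2$$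 exists, and $\dfrac{1}{2S}\le\beta_k(A)\le\dfrac12$. 2. In the limit $i\to\infty$ followed by $\mu\to0^+$, the sum $\sum_{j=1}^i\big[\mathbf{q}_k(i,j)-\mathbb{E}\,\mathbf{q}_k(i,j)\big]$ converges in distribution to a zero-mean $R$-variate Gaussian vector with covariance matrix $\beta_k(A)\,\Lambda_k$, where $\Lambda_k$ is the $R\times R$ covariance matrix of $\mathbf{d}_k(i)$ (the same for all $i$), $$[\Lambda_k]_{r_1r_2}=\mathbb{E}\Big[\big(\mathbf{d}_k^{(r_1)}(i)-\mathbb{E}\,\mathbf{d}_k^{(r_1)}(i)\big)\big(\mathbf{d}_k^{(r_2)}(i)-\mathbb{E}\,\mathbf{d}_k^{(r_2)}(i)\big)\Big].$$ That is, for each fixed $\mu\in(0,1)$ the sum converges in distribution as $i\to\infty$ to a (steady-state) law $\nu_\mu$, and $\nu_\mu$ converges weakly to $\mathcal{N}_R(0,\beta_k(A)\Lambda_k)$ as $\mu\to0^+$. -/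

import Mathlib

open MeasureTheory ProbabilityTheory Filter Topology

noncomputable section

namespace MultiTask

/-- The two decision problems over the finite alphabet `{1, …, M}` (here `Fin M`), indexed by the
number `R` of branches of the algorithm run by each agent.
* `informed p`: the agents know the `H` possible PMFs `p 1, …, p H`, and `R = H`;
* `partiallyInformed p₀`: the agents only know the PMF `p₀` of the null model, and `R = M`. -/
inductive DecisionProblem (M : ℕ) : ℕ → Type
  | informed {H : ℕ} (p : Fin H → PMF (Fin M)) : DecisionProblem M H
  | partiallyInformed (p₀ : PMF (Fin M)) : DecisionProblem M M

namespace DecisionProblem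

/-- The `r`-th entry of the data vector computed by an agent from an observation with value `a`:
the log-likelihood `log p_r(a)` for informed agents, the indicator of `a = r` for partially
informed agents. -/
def statistic {M : ℕ} : {R : ℕ} → DecisionProblem M R → Fin R → Fin M → ℝ
  | _, informed p, h, a => Real.log (p h a).toReal
  | _, partiallyInformed _, m, a => if a = m then 1 else 0

/-- `prob.IsStateOfNature π` says that `π c`, the PMF of the observations made by the agents of
cluster `c`, can be in force in the problem `prob`, all PMFs being strictly positive.
* Informed agents: every cluster works under one of the `H` hypotheses.
* Partially informed agents: either the null model `p₀` is in force for all clusters, or the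
  clusters work under arbitrary PMFs different from `p₀`. -/
def IsStateOfNature {M C : ℕ} : {R : ℕ} → DecisionProblem M R → (Fin C → PMF (Fin M)) → Prop
  | _, informed p, π => (∀ h a, p h a ≠ 0) ∧ ∀ c, ∃ h, π c = p h
  | _, partiallyInformed p₀, π =>
      (∀ a, p₀ a ≠ 0) ∧ (∀ c a, π c a ≠ 0) ∧ ((∀ c, π c = p₀) ∨ ∀ c, π c ≠ p₀)

end DecisionProblem

/-- The effective neighbors of agent `k`: the agents of the neighborhood of `k` (which contains
`k` itself) that belong to the same cluster as `k`. -/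
def effectiveNeighbors {S C : ℕ} (G : SimpleGraph (Fin S)) (cluster : Fin S → Fin C) (k : Fin S) :
    Set (Fin S) :=
  {ℓ | (ℓ = k ∨ G.Adj k ℓ) ∧ cluster ℓ = cluster k}

/-- The combination matrix under perfect clustering: a nonnegative right-stochastic matrix in
which each agent only combines the values of its effective neighbors. -/
structure IsCombinationMatrix {S C : ℕ} (G : SimpleGraph (Fin S)) (cluster : Fin S → Fin C)
    (A : Matrix (Fin S) (Fin S) ℝ) : Prop where
  rightStochastic : A ∈ Matrix.rowStochastic ℝ (Fin S)
  eq_zero : ∀ k ℓ, ℓ ∉ effectiveNeighbors G cluster k → A k ℓ = 0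

variable {S M R : ℕ} {Ω : Type*}

/-- The entry `d_k^{(r)}(i)` of the data vector of agent `k` at time `i = 1, 2, …`. -/
def localData (prob : DecisionProblem M R) (x : Fin S → ℕ+ → Ω → Fin M) (r : Fin R) (k : Fin S)
    (i : ℕ+) (ω : Ω) : ℝ :=
  prob.statistic r (x k i ω)

/-- The entry `t_k^{(r)}(i, j)`, for `1 ≤ j ≤ i`, of the triangular array; `(i - j).succPNat` is
the time `i - j + 1`. -/
def arrayEntry (prob : DecisionProblem M R) (x : Fin S → ℕ+ → Ω → Fin M)
    (A : Matrix (Fin S) (Fin S) ℝ) (μ : ℝ) (k : Fin S) (r : Fin R) (i j : ℕ) (ω : Ω) : ℝ :=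
  √μ * (1 - μ) ^ (j - 1) * ∑ ℓ, (A ^ j) k ℓ * localData prob x r ℓ (i - j).succPNat ω

/-- The vector `q_k(i, j)` with entries `t_k^{(r)}(i, j)`, `r = 1, …, R`. -/
def arrayVec (prob : DecisionProblem M R) (x : Fin S → ℕ+ → Ω → Fin M)
    (A : Matrix (Fin S) (Fin S) ℝ) (μ : ℝ) (k : Fin S) (i j : ℕ) (ω : Ω) :
    EuclideanSpace ℝ (Fin R) :=
  WithLp.toLp 2 fun r => arrayEntry prob x A μ k r i j ω

/-- The sum of the centred `i`-th row of the array. -/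
def centredRowSum [MeasurableSpace Ω] (P : Measure Ω) (prob : DecisionProblem M R)
    (x : Fin S → ℕ+ → Ω → Fin M) (A : Matrix (Fin S) (Fin S) ℝ) (μ : ℝ) (k : Fin S) (i : ℕ)
    (ω : Ω) : EuclideanSpace ℝ (Fin R) :=
  ∑ j ∈ Finset.Icc 1 i, (arrayVec prob x A μ k i j ω - ∫ ω', arrayVec prob x A μ k i j ω' ∂P)

/-- The covariance matrix `Λ_k` of the data vector of agent `k`, computed at time `n`. -/
def localCovariance [MeasurableSpace Ω] (P : Measure Ω) (prob : DecisionProblem M R)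
    (x : Fin S → ℕ+ → Ω → Fin M) (k : Fin S) (n : ℕ+) : Matrix (Fin R) (Fin R) ℝ :=
  Matrix.of fun r₁ r₂ => cov[localData prob x r₁ k n, localData prob x r₂ k n; P]

/-- The `j`-th term of the series in the definition of `β_k(A)`, at step size `μ`. -/
def betaTerm (A : Matrix (Fin S) (Fin S) ℝ) (k : Fin S) (μ : ℝ) (j : ℕ+) : ℝ :=
  ∑ ℓ, μ * (1 - μ) ^ (2 * (j : ℕ) - 2) * (A ^ (j : ℕ)) k ℓ ^ 2

/-- `β_k(A)`, the limit for `μ → 0⁺` of the sum of the series. -/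
def beta (A : Matrix (Fin S) (Fin S) ℝ) (k : Fin S) : ℝ :=
  limUnder (𝓝[>] (0 : ℝ)) fun μ => ∑' j : ℕ+, betaTerm A k μ j

end MultiTask

end

/-! With delay `m = j - 1`, the centred row sum is a finite sum of independent centred vectors with
coefficients `weight A μ k m ℓ`. Powers of `A` never leave a cluster, so only data with the law of
the cluster of `k` count. The squared weights sum to a partial sum of the series defining `β_k(A)`,
and each weight is at most `√μ`.

Existence of `β_k(A)`: with `r = (1 - μ)²`, the series is `1 / (2 - μ)` times an Abel mean of the
diagonal entries of `T ^ m (A Aᵀ)`, where `T X = A X Aᵀ` contracts the entrywise sup norm. The mean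
ergodic theorem `LinearMap.exists_tendsto_abelMean` gives the limit.

Steady state: the law of the row sum does not change if delay `m` is read at time `m + 1`
(`charFun_weightedSum`), and the sums so obtained converge pointwise.

Gaussian limit: the characteristic function is a product of factors near 1. By
`norm_prod_charFun_sub_exp_le` it differs from a Gaussian one by at most `ε` times the sum of
squared weights, uniformly in `i`. The bound passes to `i → ∞`, and then `μ → 0⁺`. -/

section AbelMeans

/-! ### Abel means of a linear contraction. -/

variable {E : Type*} [NormedAddCommGroup E] [NormedSpace ℝ E]

lemma LinearMap.norm_pow_apply_le_of_norm_apply_le {T : E →ₗ[ℝ] E} (hT : ∀ v, ‖T v‖ ≤ ‖v‖)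
    (n : ℕ) (v : E) : ‖(T ^ n) v‖ ≤ ‖v‖ := by
  induction n with
  | zero => simp
  | succ n ih =>
    rw [pow_succ', Module.End.mul_apply]
    exact (hT _).trans ih

/-- If `z = y - T y` is fixed by `T`, then `T ^ n y = y - n z`, which is unbounded unless `z = 0`.
-/
lemma LinearMap.disjoint_ker_range_one_sub {T : E →ₗ[ℝ] E} (hT : ∀ v, ‖T v‖ ≤ ‖v‖) :
    Disjoint (LinearMap.ker (1 - T)) (LinearMap.range (1 - T)) := by
  rw [Submodule.disjoint_def]
  rintro z hz ⟨y, rfl⟩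
  set z := (1 - T) y with hz_def
  have hTz : T z = z := by
    have : z - T z = 0 := by simpa using hz
    exact (sub_eq_zero.1 this).symm
  have hTy : T y = y - z := by simp [hz_def]
  have key (n : ℕ) : (T ^ n) y = y - (n : ℝ) • z := by
    induction n with
    | zero => simp
    | succ n ih =>
      rw [pow_succ', Module.End.mul_apply, ih, map_sub, map_smul, hTz, hTy]
      push_cast
      module
  by_contra hne
  have hpos : 0 < ‖z‖ := norm_pos_iff.2 hne
  obtain ⟨n, hn⟩ := exists_nat_gt (2 * ‖y‖ / ‖z‖)
  rw [div_lt_iff₀ hpos] at hn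
  have h1 : (n : ℝ) * ‖z‖ = ‖y - (T ^ n) y‖ := by
    rw [key]
    simp [norm_smul]
  have h2 := norm_sub_le y ((T ^ n) y)
  have h3 := LinearMap.norm_pow_apply_le_of_norm_apply_le hT n y
  linarith

variable [FiniteDimensional ℝ E]

lemma LinearMap.summable_smul_pow_apply {T : E →ₗ[ℝ] E} (hT : ∀ v, ‖T v‖ ≤ ‖v‖) {r : ℝ}
    (hr : r ∈ Set.Ioo (0 : ℝ) 1) (v : E) : Summable fun n : ℕ => r ^ n • (T ^ n) v := by
  have := FiniteDimensional.complete ℝ E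
  refine Summable.of_norm_bounded
    ((summable_geometric_of_lt_one hr.1.le hr.2).mul_right ‖v‖) fun n => ?_
  rw [norm_smul, norm_pow, Real.norm_of_nonneg hr.1.le]
  gcongr
  exacts [pow_nonneg hr.1.le n, LinearMap.norm_pow_apply_le_of_norm_apply_le hT n v]

omit [FiniteDimensional ℝ E] in
lemma LinearMap.norm_abelMean_le {T : E →ₗ[ℝ] E} (hT : ∀ v, ‖T v‖ ≤ ‖v‖) {r : ℝ}
    (hr : r ∈ Set.Ioo (0 : ℝ) 1) (v : E) : ‖(1 - r) • ∑' n : ℕ, r ^ n • (T ^ n) v‖ ≤ ‖v‖ := by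
  have h1r : 0 < 1 - r := sub_pos.2 hr.2
  rw [norm_smul, Real.norm_of_nonneg h1r.le]
  have hs : HasSum (fun n : ℕ => r ^ n * ‖v‖) ((1 - r)⁻¹ * ‖v‖) :=
    (hasSum_geometric_of_lt_one hr.1.le hr.2).mul_right _
  have : ‖∑' n : ℕ, r ^ n • (T ^ n) v‖ ≤ (1 - r)⁻¹ * ‖v‖ := by
    refine tsum_of_norm_bounded hs fun n => ?_
    rw [norm_smul, norm_pow, Real.norm_of_nonneg hr.1.le]
    gcongr
    exacts [pow_nonneg hr.1.le n, LinearMap.norm_pow_apply_le_of_norm_apply_le hT n v]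
  calc (1 - r) * _ ≤ (1 - r) * ((1 - r)⁻¹ * ‖v‖) := by gcongr
    _ = ‖v‖ := by field_simp

/-- Mean ergodic theorem for the Abel means of a contraction of a finite-dimensional space. -/
lemma LinearMap.exists_tendsto_abelMean {T : E →ₗ[ℝ] E} (hT : ∀ v, ‖T v‖ ≤ ‖v‖) (v : E) :
    ∃ w, Tendsto (fun r : ℝ => (1 - r) • ∑' n : ℕ, r ^ n • (T ^ n) v) (𝓝[<] 1) (𝓝 w) := by
  -- By rank-nullity, disjointness makes kernel and range complementary; the limit is the fixed
  -- component `a`.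
  have htop : LinearMap.ker (1 - T) ⊔ LinearMap.range (1 - T) = ⊤ :=
    Submodule.eq_top_of_disjoint _ _ (by rw [add_comm, LinearMap.finrank_range_add_finrank_ker])
      (LinearMap.disjoint_ker_range_one_sub hT)
  obtain ⟨a, ha, b, ⟨y, rfl⟩, rfl⟩ := Submodule.mem_sup.1 (htop ▸ Submodule.mem_top (x := v))
  have hTa : T a = a := by
    have : a - T a = 0 := by simpa using ha
    exact (sub_eq_zero.1 this).symm
  have hTna (n : ℕ) : (T ^ n) a = a := by
    induction n with
    | zero => simp
    | succ n ih => rw [pow_succ', Module.End.mul_apply, ih, hTa]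
  have hmem : ∀ᶠ r : ℝ in 𝓝[<] 1, r ∈ Set.Ioo (0 : ℝ) 1 := Ioo_mem_nhdsLT zero_lt_one
  have hlim : Tendsto (fun r : ℝ => 1 - r) (𝓝[<] 1) (𝓝 0) := by
    have : Continuous fun r : ℝ => 1 - r := by fun_prop
    simpa using (this.tendsto 1).mono_left nhdsWithin_le_nhds
  refine ⟨a, ?_⟩
  -- On the range the series telescopes, leaving `1 - r` times a bounded quantity.
  have hformula : ∀ᶠ r : ℝ in 𝓝[<] 1,
      a + ((1 - r) • y - (1 - r) • ((1 - r) • ∑' n : ℕ, r ^ n • (T ^ n) (T y))) =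
        (1 - r) • ∑' n : ℕ, r ^ n • (T ^ n) (a + (1 - T) y) := by
    filter_upwards [hmem] with r hr
    have hsa := LinearMap.summable_smul_pow_apply hT hr a
    have hsy := LinearMap.summable_smul_pow_apply hT hr y
    have hsT := LinearMap.summable_smul_pow_apply hT hr (T y)
    have e1 : ∑' n : ℕ, r ^ n • (T ^ n) (a + (1 - T) y) = ∑' n : ℕ, r ^ n • (T ^ n) a +
        (∑' n : ℕ, r ^ n • (T ^ n) y - ∑' n : ℕ, r ^ n • (T ^ n) (T y)) := by
      rw [← hsy.tsum_sub hsT, ← hsa.tsum_add (hsy.sub hsT)]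
      simp [smul_sub]
    have e2 : ∑' n : ℕ, r ^ n • (T ^ n) a = (1 - r)⁻¹ • a := by
      simp_rw [hTna]
      rw [(summable_geometric_of_lt_one hr.1.le hr.2).tsum_smul_const,
        tsum_geometric_of_lt_one hr.1.le hr.2]
    have e3 : ∑' n : ℕ, r ^ n • (T ^ n) y = y + r • ∑' n : ℕ, r ^ n • (T ^ n) (T y) := by
      rw [hsy.tsum_eq_zero_add, ← tsum_const_smul'']
      simp [pow_succ', smul_smul, ← Module.End.mul_apply, (Commute.refl T).pow_right _ |>.eq]
    have h1r : 1 - r ≠ 0 := (sub_pos.2 hr.2).ne'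
    rw [e1, e2, e3, smul_add (1 - r) ((1 - r)⁻¹ • a), smul_smul (1 - r) (1 - r)⁻¹,
      mul_inv_cancel₀ h1r]
    module
  refine Tendsto.congr' hformula ?_
  have hb : Tendsto (fun r : ℝ => (1 - r) • ((1 - r) • ∑' n : ℕ, r ^ n • (T ^ n) (T y)))
      (𝓝[<] 1) (𝓝 0) := by
    refine squeeze_zero_norm' (a := fun r => (1 - r) * ‖T y‖) ?_ (by simpa using hlim.mul_const _)
    filter_upwards [hmem] with r hr
    rw [norm_smul, Real.norm_of_nonneg (sub_pos.2 hr.2).le]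
    exact mul_le_mul_of_nonneg_left (LinearMap.norm_abelMean_le hT hr _) (sub_pos.2 hr.2).le
  have ht := ((hlim.smul_const y).sub hb).const_add a
  simpa using ht

end AbelMeans

/-! ### Powers of a row-stochastic matrix. -/

section RowStochastic

attribute [local instance] Matrix.normedAddCommGroup Matrix.normedSpace

variable {n : Type*} [Fintype n] [DecidableEq n] {A : Matrix n n ℝ}

/-- In the entrywise sup norm: each entry of `A X Aᵀ` is a weighted average of entries of `X`. -/
lemma Matrix.norm_mul_mul_transpose_le_of_mem_rowStochastic (hA : A ∈ Matrix.rowStochastic ℝ n)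
    (X : Matrix n n ℝ) : ‖A * X * A.transpose‖ ≤ ‖X‖ := by
  rw [Matrix.norm_le_iff (norm_nonneg _)]
  intro i j
  have h0 (i j) : 0 ≤ A i j := Matrix.nonneg_of_mem_rowStochastic hA
  simp only [Matrix.mul_apply, Matrix.transpose_apply, Finset.sum_mul]
  calc ‖∑ b, ∑ a, A i a * X a b * A j b‖ ≤ ∑ b, ∑ a, A i a * ‖X‖ * A j b := by
        refine (norm_sum_le _ _).trans (Finset.sum_le_sum fun b _ => ?_)
        refine (norm_sum_le _ _).trans (Finset.sum_le_sum fun a _ => ?_)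
        rw [norm_mul, norm_mul, Real.norm_of_nonneg (h0 _ _), Real.norm_of_nonneg (h0 _ _)]
        gcongr
        exacts [h0 _ _, h0 _ _, Matrix.norm_entry_le_entrywise_sup_norm X]
    _ = ‖X‖ := by
        simp_rw [← Finset.sum_mul, ← Finset.mul_sum,
          Matrix.sum_row_of_mem_rowStochastic hA]
        simp

/-- The Abel means of the squared norms of the rows of the powers of a stochastic matrix
converge. -/
lemma Matrix.exists_tendsto_abelMean_sum_sq_of_mem_rowStochastic
    (hA : A ∈ Matrix.rowStochastic ℝ n) (k : n) :
    ∃ w : ℝ, Tendsto (fun r : ℝ => (1 - r) * ∑' m : ℕ, r ^ m * ∑ l, (A ^ (m + 1)) k l ^ 2)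
      (𝓝[<] 1) (𝓝 w) := by
  -- Squared row norms are not linear in the powers of `A`, but they are diagonal entries of an
  -- orbit of this linear map.
  let T : Matrix n n ℝ →ₗ[ℝ] Matrix n n ℝ :=
    (LinearMap.mulRight ℝ A.transpose).comp (LinearMap.mulLeft ℝ A)
  have hT (X) : ‖T X‖ ≤ ‖X‖ := Matrix.norm_mul_mul_transpose_le_of_mem_rowStochastic hA X
  have hTn (m : ℕ) : (T ^ m) (A * A.transpose) = A ^ (m + 1) * (A ^ (m + 1)).transpose := by
    induction m with
    | zero => simp
    | succ m ih =>
      rw [pow_succ', Module.End.mul_apply, ih, pow_succ' A (m + 1), Matrix.transpose_mul]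
      simp [T, Matrix.mul_assoc]
  have hentry (m : ℕ) : (T ^ m) (A * A.transpose) k k = ∑ l, (A ^ (m + 1)) k l ^ 2 := by
    simp only [hTn, Matrix.mul_apply, Matrix.transpose_apply, sq]
  obtain ⟨W, hW⟩ := LinearMap.exists_tendsto_abelMean hT (A * A.transpose)
  refine ⟨W k k, ?_⟩
  let e : Matrix n n ℝ →L[ℝ] ℝ := LinearMap.toContinuousLinearMap (Matrix.entryLinearMap ℝ ℝ k k)
  have he (X) : e X = X k k := rfl
  have h := (e.continuous.tendsto W).comp hW
  rw [he] at h
  refine h.congr' ?_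
  filter_upwards [Ioo_mem_nhdsLT (zero_lt_one (α := ℝ))] with r hr
  have hs := LinearMap.summable_smul_pow_apply hT hr (A * A.transpose)
  simp only [Function.comp_apply, map_smul, smul_eq_mul]
  refine congrArg _ ((e.map_tsum hs).trans (tsum_congr fun m => ?_))
  rw [map_smul, he, hentry, smul_eq_mul]

lemma Matrix.sum_sq_le_one_of_mem_rowStochastic (hA : A ∈ Matrix.rowStochastic ℝ n) (k : n) :
    ∑ l, A k l ^ 2 ≤ 1 := by
  rw [← Matrix.sum_row_of_mem_rowStochastic hA k]
  refine Finset.sum_le_sum fun l _ => ?_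
  have h0 : 0 ≤ A k l := Matrix.nonneg_of_mem_rowStochastic hA
  have h1 : A k l ≤ 1 := Matrix.le_one_of_mem_rowStochastic hA
  nlinarith

lemma Matrix.inv_card_le_sum_sq_of_mem_rowStochastic (hA : A ∈ Matrix.rowStochastic ℝ n) (k : n) :
    (Fintype.card n : ℝ)⁻¹ ≤ ∑ l, A k l ^ 2 := by
  have h := sq_sum_le_card_mul_sum_sq (s := Finset.univ) (f := fun l => A k l)
  rw [Matrix.sum_row_of_mem_rowStochastic hA k, Finset.card_univ, one_pow] at h
  have : 0 < (Fintype.card n : ℝ) := by exact_mod_cast Fintype.card_pos_iff.2 ⟨k⟩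
  rw [inv_le_iff_one_le_mul₀ this, mul_comm]
  linarith

end RowStochastic

/-! ### Existence and bounds of `β_k(A)`. -/

namespace MultiTask

section Beta

variable {S : ℕ} {A : Matrix (Fin S) (Fin S) ℝ}

lemma betaTerm_succPNat (k : Fin S) (μ : ℝ) (m : ℕ) :
    betaTerm A k μ m.succPNat = μ * (((1 - μ) ^ 2) ^ m * ∑ l, (A ^ (m + 1)) k l ^ 2) := by
  simp only [betaTerm, Nat.succPNat_coe, Nat.succ_eq_add_one, Finset.mul_sum, ← pow_mul]
  refine Finset.sum_congr rfl fun l _ => ?_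
  rw [show 2 * (m + 1) - 2 = 2 * m by lia]
  ring

lemma one_sub_sq_mem_Ioo {μ : ℝ} (hμ : μ ∈ Set.Ioo (0 : ℝ) 1) :
    (1 - μ) ^ 2 ∈ Set.Ioo (0 : ℝ) 1 := by
  obtain ⟨h0, h1⟩ := hμ
  constructor <;> nlinarith

/-- The comparison series for both bounds; `1 - (1 - μ)² = μ (2 - μ)` is the origin of the factor
1/2 as `μ → 0⁺`. -/
lemma hasSum_geometric_mul {μ : ℝ} (hμ : μ ∈ Set.Ioo (0 : ℝ) 1) (c : ℝ) :
    HasSum (fun m : ℕ => μ * (((1 - μ) ^ 2) ^ m * c)) (c / (2 - μ)) := by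
  have hr := one_sub_sq_mem_Ioo hμ
  convert! ((hasSum_geometric_of_lt_one hr.1.le hr.2).mul_right c).mul_left μ using 1
  have h1 : μ ≠ 0 := hμ.1.ne'
  have h2 : 2 - μ ≠ 0 := by linarith [hμ.2]
  rw [show 1 - (1 - μ) ^ 2 = μ * (2 - μ) by ring]
  field_simp

lemma tendsto_div_two_sub (c : ℝ) :
    Tendsto (fun μ : ℝ => c / (2 - μ)) (𝓝[>] 0) (𝓝 (c / 2)) := by
  have : ContinuousAt (fun μ : ℝ => c / (2 - μ)) 0 :=
    ContinuousAt.div (by fun_prop) (by fun_prop) (by norm_num)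
  simpa using this.tendsto.mono_left nhdsWithin_le_nhds

lemma summable_betaTerm_succPNat (hA : A ∈ Matrix.rowStochastic ℝ (Fin S)) (k : Fin S)
    {μ : ℝ} (hμ : μ ∈ Set.Ioo (0 : ℝ) 1) :
    Summable fun m : ℕ => betaTerm A k μ m.succPNat := by
  refine (hasSum_geometric_mul hμ 1).summable.of_nonneg_of_le (fun m => ?_) (fun m => ?_)
  all_goals rw [betaTerm_succPNat]
  · have := hμ.1.le
    positivity
  · have := hμ.1.le
    gcongr
    exact Matrix.sum_sq_le_one_of_mem_rowStochastic (pow_mem hA _) k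

lemma summable_betaTerm (hA : A ∈ Matrix.rowStochastic ℝ (Fin S)) (k : Fin S)
    {μ : ℝ} (hμ : μ ∈ Set.Ioo (0 : ℝ) 1) :
    Summable (betaTerm A k μ) :=
  (Equiv.pnatEquivNat.symm.summable_iff (f := betaTerm A k μ)).1
    (summable_betaTerm_succPNat hA k hμ)

lemma tsum_betaTerm (k : Fin S) (μ : ℝ) :
    ∑' j, betaTerm A k μ j = ∑' m : ℕ, betaTerm A k μ m.succPNat :=
  (Equiv.pnatEquivNat.symm.tsum_eq (betaTerm A k μ)).symm

lemma tsum_betaTerm_mem_Icc (hA : A ∈ Matrix.rowStochastic ℝ (Fin S)) (k : Fin S)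
    {μ : ℝ} (hμ : μ ∈ Set.Ioo (0 : ℝ) 1) :
    ∑' j, betaTerm A k μ j ∈ Set.Icc ((S : ℝ)⁻¹ / (2 - μ)) (1 / (2 - μ)) := by
  rw [tsum_betaTerm]
  have hμ0 := hμ.1.le
  constructor
  · refine hasSum_le (fun m => ?_) (hasSum_geometric_mul hμ _)
      (summable_betaTerm_succPNat hA k hμ).hasSum
    rw [betaTerm_succPNat]
    gcongr
    simpa using Matrix.inv_card_le_sum_sq_of_mem_rowStochastic (pow_mem hA (m + 1)) k
  · refine hasSum_le (fun m => ?_) (summable_betaTerm_succPNat hA k hμ).hasSum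
      (hasSum_geometric_mul hμ _)
    rw [betaTerm_succPNat]
    gcongr
    exact Matrix.sum_sq_le_one_of_mem_rowStochastic (pow_mem hA _) k

lemma tendsto_tsum_betaTerm (hA : A ∈ Matrix.rowStochastic ℝ (Fin S)) (k : Fin S) :
    Tendsto (fun μ : ℝ => ∑' j, betaTerm A k μ j) (𝓝[>] 0) (𝓝 (beta A k)) := by
  -- It remains to show that some limit exists; the witness is half the Abel limit.
  refine tendsto_nhds_limUnder ?_
  obtain ⟨w, hw⟩ := Matrix.exists_tendsto_abelMean_sum_sq_of_mem_rowStochastic hA k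
  have hr : Tendsto (fun μ : ℝ => (1 - μ) ^ 2) (𝓝[>] 0) (𝓝[<] 1) := by
    refine tendsto_nhdsWithin_iff.2 ⟨?_, ?_⟩
    · have : Continuous fun μ : ℝ => (1 - μ) ^ 2 := by fun_prop
      simpa using (this.tendsto 0).mono_left nhdsWithin_le_nhds
    · filter_upwards [Ioo_mem_nhdsGT (zero_lt_one (α := ℝ))] with μ hμ
      exact (one_sub_sq_mem_Ioo hμ).2
  refine ⟨_, ((tendsto_div_two_sub 1).mul (hw.comp hr)).congr' ?_⟩
  filter_upwards [Ioo_mem_nhdsGT (zero_lt_one (α := ℝ))] with μ hμ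
  have h1 : 2 - μ ≠ 0 := by linarith [hμ.2]
  simp only [Function.comp_apply, tsum_betaTerm, betaTerm_succPNat, tsum_mul_left]
  rw [show 1 - (1 - μ) ^ 2 = μ * (2 - μ) by ring]
  field_simp

lemma one_div_le_beta (hA : A ∈ Matrix.rowStochastic ℝ (Fin S)) (k : Fin S) :
    1 / (2 * (S : ℝ)) ≤ beta A k := by
  have h : (S : ℝ)⁻¹ / 2 ≤ beta A k := by
    refine le_of_tendsto_of_tendsto (tendsto_div_two_sub _) (tendsto_tsum_betaTerm hA k) ?_
    filter_upwards [Ioo_mem_nhdsGT (zero_lt_one (α := ℝ))] with μ hμ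
    exact (tsum_betaTerm_mem_Icc hA k hμ).1
  rwa [mul_comm, ← div_div, one_div]

lemma beta_le_half (hA : A ∈ Matrix.rowStochastic ℝ (Fin S)) (k : Fin S) :
    beta A k ≤ 1 / 2 := by
  refine le_of_tendsto_of_tendsto (tendsto_tsum_betaTerm hA k) (tendsto_div_two_sub _) ?_
  filter_upwards [Ioo_mem_nhdsGT (zero_lt_one (α := ℝ))] with μ hμ
  exact (tsum_betaTerm_mem_Icc hA k hμ).2

end Beta

end MultiTask

/-! ### Characteristic functions and Gaussian approximation. -/

lemma norm_prod_sub_prod_le_sum_norm_sub {ι 𝕜 : Type*} [NormedField 𝕜] (s : Finset ι)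
    {z w : ι → 𝕜} (hz : ∀ i ∈ s, ‖z i‖ ≤ 1) (hw : ∀ i ∈ s, ‖w i‖ ≤ 1) :
    ‖∏ i ∈ s, z i - ∏ i ∈ s, w i‖ ≤ ∑ i ∈ s, ‖z i - w i‖ := by
  classical
  induction s using Finset.induction_on with
  | empty => simp
  | insert a s ha ih =>
    rw [Finset.prod_insert ha, Finset.prod_insert ha, Finset.sum_insert ha]
    have hP : ‖∏ i ∈ s, z i‖ ≤ 1 := by
      rw [norm_prod]
      exact Finset.prod_le_one (fun i _ => norm_nonneg _)
        fun i hi => hz i (Finset.mem_insert_of_mem hi)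
    have h1 := ih (fun i hi => hz i (Finset.mem_insert_of_mem hi))
      fun i hi => hw i (Finset.mem_insert_of_mem hi)
    -- Exchange one factor at a time; the unexchanged factors have norm at most 1.
    calc ‖z a * ∏ i ∈ s, z i - w a * ∏ i ∈ s, w i‖
        = ‖(z a - w a) * ∏ i ∈ s, z i + w a * (∏ i ∈ s, z i - ∏ i ∈ s, w i)‖ := by ring_nf
      _ ≤ ‖z a - w a‖ * ‖∏ i ∈ s, z i‖ + ‖w a‖ * ‖∏ i ∈ s, z i - ∏ i ∈ s, w i‖ := by
        rw [← norm_mul, ← norm_mul]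
        exact norm_add_le _ _
      _ ≤ ‖z a - w a‖ * 1 + 1 * ∑ i ∈ s, ‖z i - w i‖ := by
        gcongr
        exact hw a (Finset.mem_insert_self a s)
      _ = _ := by ring

section CharFun

/-- Both functions are `1 - s² v / 2 + o(s²)`; a finite second moment is enough for this. -/
lemma charFun_sub_exp_isLittleO_real {η : Measure ℝ} [IsProbabilityMeasure η]
    (h2 : MemLp id 2 η) (h0 : ∫ y, y ∂η = 0) :
    (fun s : ℝ => charFun η s - Complex.exp (-(s ^ 2 * ∫ y, y ^ 2 ∂η : ℝ) / 2))
      =o[𝓝 0] fun s : ℝ => s ^ 2 := by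
  set v := ∫ y, y ^ 2 ∂η with hv
  have h1 : (fun s : ℝ => charFun η s - (1 - (s ^ 2 * v : ℝ) / 2))
      =o[𝓝 0] fun s : ℝ => s ^ 2 := by
    have hc : ContDiff ℝ 2 (charFun η) := by exact_mod_cast contDiff_charFun (n := 2) (by simpa)
    have := taylor_isLittleO_univ (n := 2) (x₀ := 0) (by exact_mod_cast hc)
    refine (this.congr_left fun s => ?_).congr_right fun s => by simp
    have hI : ∫ y, (y : ℂ) ∂η = 0 := by
      rw [integral_complex_ofReal, h0, Complex.ofReal_zero]
    have hT := taylorWithinEval_charFun_zero (μ := η) (n := 2) (by simpa) s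
    rw [hT]
    simp only [Finset.sum_range_succ, Finset.sum_range_zero]
    simp only [pow_zero, pow_one, h0, ← hv]
    simp
    rw [mul_pow, Complex.I_sq]
    ring
  have h3 : (fun s : ℝ => (1 - (s ^ 2 * v : ℝ) / 2 : ℂ) -
      Complex.exp (-(s ^ 2 * v : ℝ) / 2)) =o[𝓝 0] fun s : ℝ => s ^ 2 := by
    have he : (fun u : ℂ => Complex.exp u - 1 - u) =o[𝓝 0] fun u => u := by
      have := (Complex.hasDerivAt_exp 0).isLittleO
      simpa using this
    have ht : Tendsto (fun s : ℝ => (-(s ^ 2 * v : ℝ) / 2 : ℂ)) (𝓝 0) (𝓝 0) := by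
      have : Continuous fun s : ℝ => (-(s ^ 2 * v : ℝ) / 2 : ℂ) := by fun_prop
      simpa using this.tendsto 0
    have hO : (fun s : ℝ => (-(s ^ 2 * v : ℝ) / 2 : ℂ)) =O[𝓝 0] fun s : ℝ => s ^ 2 := by
      refine Asymptotics.IsBigO.of_bound (|v| / 2) (Eventually.of_forall fun s => ?_)
      simp
      apply le_of_eq
      ring
    refine ((he.comp_tendsto ht).trans_isBigO hO).neg_left.congr_left fun s => ?_
    simp only [Function.comp_apply]
    ring
  refine (h1.add h3).congr_left fun s => ?_
  ring

variable {E : Type*} [NormedAddCommGroup E] [InnerProductSpace ℝ E] [MeasurableSpace E]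
  [BorelSpace E] [SecondCountableTopology E]

lemma charFun_map_inner (ρ : Measure E) (t : E) (s : ℝ) :
    charFun (ρ.map fun y => inner ℝ t y) s = charFun ρ (s • t) := by
  have hm : Measurable fun y : E => inner ℝ t y := by fun_prop
  rw [charFun_apply_real, charFun_apply, integral_map hm.aemeasurable (by fun_prop)]
  simp [real_inner_smul_right, real_inner_comm]

/-- The characteristic function of a centred law agrees, up to the second order and along every
line, with that of the Gaussian law with the same covariance. -/
lemma charFun_sub_exp_isLittleO [CompleteSpace E] {ρ : Measure E} [IsProbabilityMeasure ρ]
    (h2 : MemLp id 2 ρ) (h0 : ∫ y, y ∂ρ = 0) (t : E) :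
    (fun s : ℝ => charFun ρ (s • t) - Complex.exp (-(s ^ 2 * covarianceBilin ρ t t : ℝ) / 2))
      =o[𝓝 0] fun s : ℝ => s ^ 2 := by
  have hm : Measurable fun y : E => inner ℝ t y := by fun_prop
  have hint : Integrable (fun y : E => y) ρ := h2.integrable (by norm_num)
  have hi : ∫ y, inner ℝ t y ∂ρ = 0 := by
    rw [integral_inner hint, h0, inner_zero_right]
  have hp := Measure.isProbabilityMeasure_map (μ := ρ) hm.aemeasurable
  have h2' : MemLp id 2 (ρ.map fun y => inner ℝ t y) :=
    (memLp_map_measure_iff aestronglyMeasurable_id hm.aemeasurable).2 (h2.const_inner t)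
  have h := charFun_sub_exp_isLittleO_real h2' (by
    rw [integral_map hm.aemeasurable (by fun_prop), hi])
  have hv : ∫ y, y ^ 2 ∂(ρ.map fun y => inner ℝ t y) = covarianceBilin ρ t t := by
    rw [covarianceBilin_self h2, variance_eq_integral hm.aemeasurable,
      integral_map hm.aemeasurable (by fun_prop), hi]
    simp
  simpa only [hv, charFun_map_inner] using h

lemma ProbabilityTheory.iIndepFun.charFun_map_sum_smul {Ω κ : Type*} [MeasurableSpace Ω]
    [Fintype κ] {P : Measure Ω} {X : κ → Ω → E} (hX : iIndepFun X P)
    (hm : ∀ i, AEMeasurable (X i) P) (c : κ → ℝ) (t : E) :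
    charFun (P.map fun ω => ∑ i, c i • X i ω) t = ∏ i, charFun (P.map (X i)) (c i • t) := by
  have h := iIndepFun.charFun_map_fun_sum_eq_prod (X := fun i ω => c i • X i ω)
    (fun i => (hm i).const_smul _) (hX.comp (fun i y => c i • y) fun i => by fun_prop)
  rw [h, Finset.prod_apply]
  exact Finset.prod_congr rfl fun i _ => charFun_map_smul_comp (hm i) _ _

/-- Quantitative Gaussian approximation of a weighted sum of independent copies of a centred
random vector. -/
lemma norm_prod_charFun_sub_exp_le [CompleteSpace E] {ρ : Measure E} [IsProbabilityMeasure ρ]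
    (h2 : MemLp id 2 ρ) (h0 : ∫ y, y ∂ρ = 0) (t : E) {ε : ℝ} (hε : 0 < ε) :
    ∃ δ > 0, ∀ {κ : Type} (s : Finset κ) (c : κ → ℝ), (∀ i ∈ s, |c i| < δ) →
      ‖∏ i ∈ s, charFun ρ (c i • t) -
        Complex.exp (-((∑ i ∈ s, c i ^ 2) * covarianceBilin ρ t t : ℝ) / 2)‖ ≤
          ε * ∑ i ∈ s, c i ^ 2 := by
  -- This `δ` depends on `ρ`, `t` and `ε` only, so the estimate is uniform in the number of terms.
  obtain ⟨δ, hδ, h⟩ := Metric.eventually_nhds_iff.1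
    ((charFun_sub_exp_isLittleO h2 h0 t).bound hε)
  refine ⟨δ, hδ, fun s c hc => ?_⟩
  have he : Complex.exp (-((∑ i ∈ s, c i ^ 2) * covarianceBilin ρ t t : ℝ) / 2) =
      ∏ i ∈ s, Complex.exp (-(c i ^ 2 * covarianceBilin ρ t t : ℝ) / 2) := by
    rw [← Complex.exp_sum]
    congr 1
    push_cast
    rw [← Finset.sum_div, Finset.sum_neg_distrib, Finset.sum_mul]
  rw [he, Finset.mul_sum]
  refine (norm_prod_sub_prod_le_sum_norm_sub s (fun i _ => norm_charFun_le_one _)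
    fun i _ => ?_).trans (Finset.sum_le_sum fun i hi => ?_)
  · rw [Complex.norm_exp, show (-(c i ^ 2 * covarianceBilin ρ t t : ℝ) / 2 : ℂ) =
      ((-(c i ^ 2 * covarianceBilin ρ t t) / 2 : ℝ) : ℂ) by push_cast; ring, Complex.ofReal_re,
      Real.exp_le_one_iff]
    have := mul_nonneg (sq_nonneg (c i)) (covarianceBilin_self_nonneg (μ := ρ) t)
    linarith
  · simpa using h (y := c i) (by simpa using hc i hi)

end CharFun

/-! ### The row sum as a weighted independent sum, and its steady state. -/

namespace MultiTask

variable {S C M R : ℕ}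

section CombinationMatrix

variable {G : SimpleGraph (Fin S)} {cluster : Fin S → Fin C} {A : Matrix (Fin S) (Fin S) ℝ}

lemma IsCombinationMatrix.pow_apply_eq_zero (hA : IsCombinationMatrix G cluster A) (j : ℕ)
    {k ℓ : Fin S} (h : cluster ℓ ≠ cluster k) : (A ^ j) k ℓ = 0 := by
  induction j generalizing ℓ with
  | zero =>
    rw [pow_zero, Matrix.one_apply_ne]
    rintro rfl
    exact h rfl
  | succ j ih =>
    rw [pow_succ, Matrix.mul_apply]
    refine Finset.sum_eq_zero fun m _ => ?_
    by_cases hm : cluster m = cluster k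
    · rw [hA.eq_zero m ℓ fun hmem => h (hmem.2.trans hm), mul_zero]
    · rw [ih hm, zero_mul]

end CombinationMatrix

/-- The data vector computed from an observation, centred under the PMF `q`. -/
noncomputable def centredStatistic (prob : DecisionProblem M R) (q : PMF (Fin M)) (a : Fin M) :
    EuclideanSpace ℝ (Fin R) :=
  WithLp.toLp 2 (fun r => prob.statistic r a) -
    ∫ b, WithLp.toLp 2 (fun r => prob.statistic r b) ∂q.toMeasure

/-- The law of the centred data vector under the PMF `q`. -/
noncomputable def centredLaw (prob : DecisionProblem M R) (q : PMF (Fin M)) :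
    Measure (EuclideanSpace ℝ (Fin R)) :=
  q.toMeasure.map (centredStatistic prob q)

/-- The weight of the datum of agent `ℓ` with delay `m` in the status of agent `k`. -/
noncomputable def weight (A : Matrix (Fin S) (Fin S) ℝ) (μ : ℝ) (k : Fin S) (m : ℕ)
    (ℓ : Fin S) : ℝ :=
  √μ * (1 - μ) ^ m * (A ^ (m + 1)) k ℓ

/-- The combination of the first `i` delays, where the datum with delay `m` is taken at
time `τ m`. -/
noncomputable def weightedSum {Ω : Type*} (prob : DecisionProblem M R) (q : PMF (Fin M))
    (x : Fin S → ℕ+ → Ω → Fin M) (A : Matrix (Fin S) (Fin S) ℝ) (μ : ℝ) (k : Fin S)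
    (τ : ℕ → ℕ+) (i : ℕ) (ω : Ω) : EuclideanSpace ℝ (Fin R) :=
  ∑ m ∈ Finset.range i, ∑ ℓ, weight A μ k m ℓ • centredStatistic prob q (x ℓ (τ m) ω)

section CentredLaw

variable (prob : DecisionProblem M R) (q : PMF (Fin M))

lemma measurable_centredStatistic : Measurable (centredStatistic prob q) :=
  Measurable.of_discrete

instance : IsProbabilityMeasure (centredLaw prob q) :=
  Measure.isProbabilityMeasure_map (measurable_centredStatistic prob q).aemeasurable

lemma memLp_centredLaw : MemLp id 2 (centredLaw prob q) :=
  (memLp_map_measure_iff aestronglyMeasurable_id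
    (measurable_centredStatistic prob q).aemeasurable).2 (by exact MemLp.of_discrete)

lemma integral_centredLaw : ∫ y, y ∂(centredLaw prob q) = 0 := by
  rw [centredLaw, integral_map (measurable_centredStatistic prob q).aemeasurable (by fun_prop)]
  simp only [centredStatistic]
  rw [integral_sub Integrable.of_finite (integrable_const _)]
  simp

end CentredLaw

section Weight

variable {A : Matrix (Fin S) (Fin S) ℝ}

/-- This identifies the variance factor of the weighted sum with the series for `β_k(A)`. -/
lemma sum_weight_sq {μ : ℝ} (hμ : 0 ≤ μ) (k : Fin S) (m : ℕ) :
    ∑ ℓ, weight A μ k m ℓ ^ 2 = betaTerm A k μ m.succPNat := by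
  rw [betaTerm_succPNat, Finset.mul_sum, Finset.mul_sum]
  refine Finset.sum_congr rfl fun l _ => ?_
  rw [weight, mul_pow, mul_pow, Real.sq_sqrt hμ, ← pow_mul, ← pow_mul, mul_comm m 2, mul_assoc]

lemma abs_weight_le (hA : A ∈ Matrix.rowStochastic ℝ (Fin S)) {μ : ℝ}
    (hμ : μ ∈ Set.Ioo (0 : ℝ) 1) (k : Fin S) (m : ℕ) (ℓ : Fin S) :
    |weight A μ k m ℓ| ≤ √μ * (1 - μ) ^ m := by
  have hAm := pow_mem hA (m + 1)
  have h0 : 0 ≤ √μ * (1 - μ) ^ m :=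
    mul_nonneg (Real.sqrt_nonneg _) (pow_nonneg (sub_nonneg.2 hμ.2.le) m)
  rw [weight, abs_mul, abs_of_nonneg h0, abs_of_nonneg (Matrix.nonneg_of_mem_rowStochastic hAm)]
  exact mul_le_of_le_one_right h0 (Matrix.le_one_of_mem_rowStochastic hAm)

/-- Uniform smallness of the summands as `μ → 0⁺`, as needed for a central limit theorem. -/
lemma abs_weight_le_sqrt (hA : A ∈ Matrix.rowStochastic ℝ (Fin S)) {μ : ℝ}
    (hμ : μ ∈ Set.Ioo (0 : ℝ) 1) (k : Fin S) (m : ℕ) (ℓ : Fin S) :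
    |weight A μ k m ℓ| ≤ √μ :=
  (abs_weight_le hA hμ k m ℓ).trans <| mul_le_of_le_one_right (Real.sqrt_nonneg _) <|
    pow_le_one₀ (sub_nonneg.2 hμ.2.le) (by linarith [hμ.1])

end Weight

section Probability

variable {G : SimpleGraph (Fin S)} {cluster : Fin S → Fin C} {A : Matrix (Fin S) (Fin S) ℝ}
  {π : Fin C → PMF (Fin M)} {Ω : Type*} [MeasurableSpace Ω] {P : Measure Ω}
  [IsProbabilityMeasure P] {x : Fin S → ℕ+ → Ω → Fin M}

omit [IsProbabilityMeasure P] in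
lemma aemeasurable_weightedSum (hlaw : ∀ k i, HasLaw (x k i) (π (cluster k)).toMeasure P)
    (prob : DecisionProblem M R) (q : PMF (Fin M)) (A : Matrix (Fin S) (Fin S) ℝ) (μ : ℝ)
    (k : Fin S) (τ : ℕ → ℕ+) (i : ℕ) : AEMeasurable (weightedSum prob q x A μ k τ i) P :=
  Finset.aemeasurable_fun_sum _ fun m _ => Finset.aemeasurable_fun_sum _ fun ℓ _ =>
    ((measurable_centredStatistic prob q).const_smul (weight A μ k m ℓ)).comp_aemeasurable
      (hlaw ℓ (τ m)).aemeasurable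

omit [IsProbabilityMeasure P] in
lemma integrable_statistic_comp (hlaw : ∀ k i, HasLaw (x k i) (π (cluster k)).toMeasure P)
    {F : Type*} [NormedAddCommGroup F] (f : Fin M → F) (ℓ : Fin S) (n : ℕ+) :
    Integrable (fun ω => f (x ℓ n ω)) P := by
  have h : Integrable f (P.map (x ℓ n)) := by
    rw [(hlaw ℓ n).map_eq]
    exact Integrable.of_finite
  exact h.comp_aemeasurable (hlaw ℓ n).aemeasurable

omit [IsProbabilityMeasure P] in
lemma centredRowSum_eq_weightedSum (hA : IsCombinationMatrix G cluster A)
    (hlaw : ∀ k i, HasLaw (x k i) (π (cluster k)).toMeasure P) (prob : DecisionProblem M R)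
    (μ : ℝ) (k : Fin S) (i : ℕ) :
    centredRowSum P prob x A μ k i = weightedSum prob (π (cluster k)) x A μ k
      (fun m => (i - (m + 1)).succPNat) i := by
  ext1 ω
  have hvec (j : ℕ) (ω : Ω) : arrayVec prob x A μ k i j ω =
      ∑ ℓ, (√μ * (1 - μ) ^ (j - 1) * (A ^ j) k ℓ) •
        WithLp.toLp 2 fun r => prob.statistic r (x ℓ (i - j).succPNat ω) := by
    ext r
    simp [arrayVec, arrayEntry, localData, Finset.mul_sum, mul_assoc]
  have hterm (j : ℕ) (ω : Ω) :
      arrayVec prob x A μ k i j ω - ∫ ω', arrayVec prob x A μ k i j ω' ∂P =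
      ∑ ℓ, (√μ * (1 - μ) ^ (j - 1) * (A ^ j) k ℓ) •
        centredStatistic prob (π (cluster k)) (x ℓ (i - j).succPNat ω) := by
    have hint (ℓ : Fin S) : Integrable (fun ω => (√μ * (1 - μ) ^ (j - 1) * (A ^ j) k ℓ) •
        WithLp.toLp 2 fun r => prob.statistic r (x ℓ (i - j).succPNat ω)) P :=
      integrable_statistic_comp hlaw (fun a => (√μ * (1 - μ) ^ (j - 1) * (A ^ j) k ℓ) •
        WithLp.toLp 2 fun r => prob.statistic r a) ℓ _
    rw [funext (hvec j), integral_finsetSum _ fun ℓ _ => hint ℓ, ← Finset.sum_sub_distrib]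
    refine Finset.sum_congr rfl fun ℓ _ => ?_
    rw [integral_smul, ← smul_sub]
    -- For agents of other clusters the centring is not the right one, but the coefficient vanishes.
    by_cases h : cluster ℓ = cluster k
    · rw [centredStatistic, ← h]
      congr 2
      exact (hlaw ℓ _).integral_comp (f := fun a => WithLp.toLp 2 fun r => prob.statistic r a)
        Measurable.of_discrete.aestronglyMeasurable
    · simp [hA.pow_apply_eq_zero j h]
  simp only [centredRowSum, hterm, weightedSum, weight]
  rw [← Finset.Ico_add_one_right_eq_Icc, Finset.sum_Ico_eq_sum_range]
  simp [add_comm]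

/-- The right-hand side does not involve `τ`: only distinctness of the times matters, which permits
time reversal. -/
lemma charFun_weightedSum (hA : IsCombinationMatrix G cluster A)
    (hlaw : ∀ k i, HasLaw (x k i) (π (cluster k)).toMeasure P)
    (hindep : iIndepFun (fun s : Fin S × ℕ+ => x s.1 s.2) P) (prob : DecisionProblem M R)
    (μ : ℝ) (k : Fin S) {τ : ℕ → ℕ+} {i : ℕ} (hτ : Set.InjOn τ (Finset.range i))
    (t : EuclideanSpace ℝ (Fin R)) :
    charFun (P.map (weightedSum prob (π (cluster k)) x A μ k τ i)) t =
      ∏ p ∈ Finset.range i ×ˢ Finset.univ,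
        charFun (centredLaw prob (π (cluster k))) (weight A μ k p.1 p.2 • t) := by
  set q := π (cluster k)
  let g (p : ↥(Finset.range i ×ˢ (Finset.univ : Finset (Fin S)))) : Fin S × ℕ+ :=
    (p.1.2, τ p.1.1)
  have hg : g.Injective := by
    rintro ⟨⟨m, ℓ⟩, hm⟩ ⟨⟨m', ℓ'⟩, hm'⟩ h
    simp only [g, Prod.mk.injEq] at h
    have := hτ (by simpa using hm) (by simpa using hm') h.2
    simp [this, h.1]
  have hX := (hindep.precomp hg).comp (fun _ => centredStatistic prob q)
    fun _ => measurable_centredStatistic prob q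
  have hm (p) : AEMeasurable (centredStatistic prob q ∘ x (g p).1 (g p).2) P :=
    (measurable_centredStatistic prob q).comp_aemeasurable (hlaw _ _).aemeasurable
  have key := hX.charFun_map_sum_smul hm (fun p => weight A μ k p.1.1 p.1.2) t
  have hsum (ω : Ω) : weightedSum prob q x A μ k τ i ω = ∑ p, weight A μ k p.1.1 p.1.2 •
      (centredStatistic prob q ∘ x (g p).1 (g p).2) ω := by
    rw [weightedSum, ← Finset.sum_product', ← Finset.sum_coe_sort]
    rfl
  rw [funext hsum, key, ← Finset.prod_coe_sort (Finset.range i ×ˢ Finset.univ)]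
  refine Finset.prod_congr rfl fun p _ => ?_
  by_cases h : cluster p.1.2 = cluster k
  · congr 1
    rw [← AEMeasurable.map_map_of_aemeasurable
      (measurable_centredStatistic prob q).aemeasurable (hlaw _ _).aemeasurable,
      (hlaw _ _).map_eq, centredLaw, h]
  -- The datum need not have law `centredLaw` here, but with weight zero both factors equal 1.
  · have h0 : weight A μ k p.1.1 p.1.2 = 0 := by rw [weight, hA.pow_apply_eq_zero _ h, mul_zero]
    have := Measure.isProbabilityMeasure_map (hm p)
    simp [h0]

omit [MeasurableSpace Ω] in
-- Since `τ` does not depend on `i`, these are partial sums of one series, dominated geometrically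
-- because the alphabet is finite.
lemma exists_tendsto_weightedSum (hA : A ∈ Matrix.rowStochastic ℝ (Fin S))
    (prob : DecisionProblem M R) (q : PMF (Fin M)) {μ : ℝ} (hμ : μ ∈ Set.Ioo (0 : ℝ) 1)
    (k : Fin S) (τ : ℕ → ℕ+) (ω : Ω) :
    ∃ y, Tendsto (fun i => weightedSum prob q x A μ k τ i ω) atTop (𝓝 y) := by
  have h0 : 0 ≤ 1 - μ := sub_nonneg.2 hμ.2.le
  have hs : Summable fun m => ∑ ℓ, weight A μ k m ℓ • centredStatistic prob q (x ℓ (τ m) ω) := by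
    refine Summable.of_norm_bounded (g := fun m => (1 - μ) ^ m *
      (√μ * ∑ _ℓ : Fin S, ∑ a, ‖centredStatistic prob q a‖))
      ((summable_geometric_of_lt_one h0 (by linarith [hμ.1])).mul_right _) fun m => ?_
    rw [← mul_assoc, mul_comm ((1 - μ) ^ m), Finset.mul_sum]
    refine (norm_sum_le _ _).trans (Finset.sum_le_sum fun ℓ _ => ?_)
    rw [norm_smul, Real.norm_eq_abs]
    refine mul_le_mul (abs_weight_le hA hμ k m ℓ) ?_ (norm_nonneg _)
      (mul_nonneg (Real.sqrt_nonneg _) (pow_nonneg h0 m))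
    exact Finset.single_le_sum (f := fun a => ‖centredStatistic prob q a‖)
      (fun a _ => norm_nonneg _) (Finset.mem_univ (x ℓ (τ m) ω))
  exact ⟨_, hs.hasSum.tendsto_sum_nat⟩

/-- Existence of the steady-state law. -/
lemma exists_tendstoInDistribution_centredRowSum (hA : IsCombinationMatrix G cluster A)
    (hlaw : ∀ k i, HasLaw (x k i) (π (cluster k)).toMeasure P)
    (hindep : iIndepFun (fun s : Fin S × ℕ+ => x s.1 s.2) P) (prob : DecisionProblem M R)
    {μ : ℝ} (hμ : μ ∈ Set.Ioo (0 : ℝ) 1) (k : Fin S) :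
    ∃ ν : ProbabilityMeasure (EuclideanSpace ℝ (Fin R)),
      TendstoInDistribution (fun i : ℕ => centredRowSum P prob x A μ k i) atTop
        id (fun _ => P) (ν : Measure (EuclideanSpace ℝ (Fin R))) := by
  set q := π (cluster k)
  have hmeas := aemeasurable_weightedSum hlaw prob q A μ k
  choose Y hY using exists_tendsto_weightedSum (x := x) hA.rightStochastic prob q hμ k
    Nat.succPNat
  have hYm : AEMeasurable Y P := aemeasurable_of_tendsto_metrizable_ae' (hmeas Nat.succPNat)
    (Eventually.of_forall hY)
  have hlim := tendstoInDistribution_of_ae_tendsto (hmeas Nat.succPNat) hYm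
    (Eventually.of_forall hY)
  -- Row `i` reads delay `m` at time `i - m`, which moves with `i`; reading it at time `m + 1` keeps
  -- the law and makes the sums nested.
  have hmap (i : ℕ) : P.map (centredRowSum P prob x A μ k i) =
      P.map (weightedSum prob q x A μ k Nat.succPNat i) := by
    rw [centredRowSum_eq_weightedSum hA hlaw]
    have := Measure.isProbabilityMeasure_map (hmeas Nat.succPNat i)
    have := Measure.isProbabilityMeasure_map (hmeas (fun m => (i - (m + 1)).succPNat) i)
    refine Measure.ext_of_charFun (funext fun t => ?_)
    rw [charFun_weightedSum hA hlaw hindep prob μ k _ t,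
      charFun_weightedSum hA hlaw hindep prob μ k Nat.succPNat_injective.injOn t]
    intro m hm m' hm' h
    have := Nat.succPNat_injective h
    simp only [Finset.coe_range, Set.mem_Iio] at hm hm'
    lia
  have hp := Measure.isProbabilityMeasure_map hYm
  obtain ⟨ν, hν⟩ : ∃ ν : ProbabilityMeasure (EuclideanSpace ℝ (Fin R)),
      (ν : Measure (EuclideanSpace ℝ (Fin R))) = P.map Y := ⟨⟨P.map Y, hp⟩, rfl⟩
  refine ⟨ν, ?_, aemeasurable_id, ?_⟩
  · intro i
    rw [centredRowSum_eq_weightedSum hA hlaw]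
    exact hmeas _ i
  · simp only [hmap, hν, Measure.map_id]
    exact hlim.tendsto

end Probability

end MultiTask

/-! ### Covariance and the limit of slow adaptation. -/

namespace MultiTask

variable {S C M R : ℕ} {G : SimpleGraph (Fin S)} {cluster : Fin S → Fin C}
  {A : Matrix (Fin S) (Fin S) ℝ} {π : Fin C → PMF (Fin M)} {Ω : Type*} [MeasurableSpace Ω]
  {P : Measure Ω} [IsProbabilityMeasure P] {x : Fin S → ℕ+ → Ω → Fin M}

omit [IsProbabilityMeasure P] in
lemma memLp_localData (hlaw : ∀ k i, HasLaw (x k i) (π (cluster k)).toMeasure P)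
    (prob : DecisionProblem M R) (r : Fin R) (k : Fin S) (n : ℕ+) :
    MemLp (localData prob x r k n) 2 P := by
  have h : MemLp (prob.statistic r) 2 (P.map (x k n)) := by
    rw [(hlaw k n).map_eq]
    exact MemLp.of_discrete
  exact (memLp_map_measure_iff h.1 (hlaw k n).aemeasurable).1 h

/-- Centring is a translation, which leaves covariances unchanged. The left side does not involve
`n`, so neither does the quadratic form of `Λ_k`. -/
lemma covarianceBilin_centredLaw (hlaw : ∀ k i, HasLaw (x k i) (π (cluster k)).toMeasure P)
    (prob : DecisionProblem M R) (k : Fin S) (n : ℕ+) (t : EuclideanSpace ℝ (Fin R)) :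
    covarianceBilin (centredLaw prob (π (cluster k))) t t =
      dotProduct t.ofLp ((localCovariance P prob x k n).mulVec t.ofLp) := by
  have hf : Measurable fun a : Fin M =>
    (WithLp.toLp 2 fun r => prob.statistic r a : EuclideanSpace ℝ (Fin R)) := .of_discrete
  have hdata : P.map (fun ω => WithLp.toLp 2 fun r => localData prob x r k n ω) =
      (π (cluster k)).toMeasure.map fun a => WithLp.toLp 2 fun r => prob.statistic r a := by
    rw [← (hlaw k n).map_eq, AEMeasurable.map_map_of_aemeasurable hf.aemeasurable
      (hlaw k n).aemeasurable]
    rfl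
  have hlaw' : centredLaw prob (π (cluster k)) =
      (P.map fun ω => WithLp.toLp 2 fun r => localData prob x r k n ω).map fun y =>
        -(∫ b, WithLp.toLp 2 (fun r => prob.statistic r b) ∂(π (cluster k)).toMeasure) + y := by
    rw [hdata, Measure.map_map (by fun_prop) hf, centredLaw]
    congr 1
    ext1 a
    simp only [centredStatistic, Function.comp_apply]
    abel
  have := Measure.isProbabilityMeasure_map (μ := (π (cluster k)).toMeasure) hf.aemeasurable
  rw [← hdata] at this
  rw [hlaw', covarianceBilin_map_const_add,
    covarianceBilin_apply_pi fun r => memLp_localData hlaw prob r k n]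
  simp only [dotProduct, Matrix.mulVec, localCovariance, Matrix.of_apply, Finset.mul_sum]
  exact Finset.sum_congr rfl fun _ _ => Finset.sum_congr rfl fun _ _ => by ring

lemma posSemidef_localCovariance (hlaw : ∀ k i, HasLaw (x k i) (π (cluster k)).toMeasure P)
    (prob : DecisionProblem M R) (k : Fin S) (n : ℕ+) :
    (localCovariance P prob x k n).PosSemidef := by
  refine Matrix.PosSemidef.of_dotProduct_mulVec_nonneg ?_ fun t => ?_
  · ext r s
    simp [localCovariance, covariance_comm]
  · have h := covarianceBilin_centredLaw hlaw prob k n (WithLp.toLp 2 t)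
    rw [star_trivial, ← h]
    exact covarianceBilin_self_nonneg _

lemma charFun_multivariateGaussian_beta (hA : A ∈ Matrix.rowStochastic ℝ (Fin S))
    (hlaw : ∀ k i, HasLaw (x k i) (π (cluster k)).toMeasure P)
    (prob : DecisionProblem M R) (k : Fin S) (n : ℕ+) (t : EuclideanSpace ℝ (Fin R)) :
    charFun (multivariateGaussian 0 (beta A k • localCovariance P prob x k n)) t =
      Complex.exp
        (-(beta A k * covarianceBilin (centredLaw prob (π (cluster k))) t t : ℝ) / 2) := by
  have hβ : 0 ≤ beta A k := le_trans (by positivity) (one_div_le_beta hA k)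
  rw [charFun_multivariateGaussian ((posSemidef_localCovariance hlaw prob k n).smul hβ),
    covarianceBilin_centredLaw hlaw prob k n, Matrix.smul_mulVec, dotProduct_smul]
  simp
  congr 1
  ring

/-- The steady-state laws converge to the Gaussian law in the slow adaptation regime. -/
lemma tendsto_charFun_steadyState (hA : IsCombinationMatrix G cluster A)
    (hlaw : ∀ k i, HasLaw (x k i) (π (cluster k)).toMeasure P)
    (hindep : iIndepFun (fun s : Fin S × ℕ+ => x s.1 s.2) P) (prob : DecisionProblem M R)
    (k : Fin S) {ν : ℝ → ProbabilityMeasure (EuclideanSpace ℝ (Fin R))}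
    (hν : ∀ μ ∈ Set.Ioo (0 : ℝ) 1,
      TendstoInDistribution (fun i : ℕ => centredRowSum P prob x A μ k i) atTop
        id (fun _ => P) (ν μ : Measure (EuclideanSpace ℝ (Fin R))))
    (t : EuclideanSpace ℝ (Fin R)) :
    Tendsto (fun μ => charFun (ν μ : Measure (EuclideanSpace ℝ (Fin R))) t) (𝓝[>] 0)
      (𝓝 (Complex.exp
        (-(beta A k * covarianceBilin (centredLaw prob (π (cluster k))) t t : ℝ) / 2))) := by
  set ρ := centredLaw prob (π (cluster k))
  set v := covarianceBilin ρ t t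
  have hS := hA.rightStochastic
  have hexp : Continuous fun b : ℝ => Complex.exp (-(b * v : ℝ) / 2) := by fun_prop
  have hgauss := (hexp.tendsto _).comp (tendsto_tsum_betaTerm hS k)
  -- It suffices to compare with the Gaussian whose variance factor is the series at the same `μ`.
  refine Tendsto.congr_dist hgauss ?_
  rw [Metric.tendsto_nhds]
  intro ε hε
  obtain ⟨δ, hδ, hclt⟩ := norm_prod_charFun_sub_exp_le (memLp_centredLaw prob (π (cluster k)))
    (integral_centredLaw prob _) t (half_pos hε)
  have hsqrt : ∀ᶠ μ : ℝ in 𝓝[>] 0, √μ < δ := by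
    have : Tendsto Real.sqrt (𝓝[>] 0) (𝓝 0) := by
      simpa using (Real.continuous_sqrt.tendsto 0).mono_left nhdsWithin_le_nhds
    exact this.eventually_lt_const hδ
  filter_upwards [Ioo_mem_nhdsGT (zero_lt_one (α := ℝ)), hsqrt] with μ hμ hμδ
  have hchar : Tendsto (fun i => charFun (P.map (centredRowSum P prob x A μ k i)) t) atTop
      (𝓝 (charFun (ν μ : Measure (EuclideanSpace ℝ (Fin R))) t)) := by
    simpa using ProbabilityMeasure.tendsto_iff_tendsto_charFun.1 (hν μ hμ).tendsto t
  have hsum : Tendsto (fun i => ∑ m ∈ Finset.range i, betaTerm A k μ m.succPNat) atTop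
      (𝓝 (∑' j, betaTerm A k μ j)) := by
    rw [tsum_betaTerm]
    exact (summable_betaTerm_succPNat hS k hμ).hasSum.tendsto_sum_nat
  have hbound (i : ℕ) : ‖charFun (P.map (centredRowSum P prob x A μ k i)) t -
      Complex.exp (-((∑ m ∈ Finset.range i, betaTerm A k μ m.succPNat) * v : ℝ) / 2)‖ ≤
        ε / 2 * ∑ m ∈ Finset.range i, betaTerm A k μ m.succPNat := by
    have h := hclt (Finset.range i ×ˢ Finset.univ) (fun p => weight A μ k p.1 p.2)
      fun p _ => (abs_weight_le_sqrt hS hμ k p.1 p.2).trans_lt hμδ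
    rw [Finset.sum_product] at h
    simp only [sum_weight_sq hμ.1.le] at h
    rwa [centredRowSum_eq_weightedSum hA hlaw, charFun_weightedSum hA hlaw hindep prob μ k]
    intro m hm m' hm' h
    have := Nat.succPNat_injective h
    simp only [Finset.coe_range, Set.mem_Iio] at hm hm'
    lia
  -- The bound is uniform in `i`, so it survives `i → ∞`; the series is at most 1, hence the error
  -- is at most `ε / 2`.
  have hle := le_of_tendsto_of_tendsto' (hchar.sub ((hexp.tendsto _).comp hsum)).norm
    (hsum.const_mul (ε / 2)) hbound
  have hβ := (tsum_betaTerm_mem_Icc hS k hμ).2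
  have hβ1 : ∑' j, betaTerm A k μ j ≤ 1 := hβ.trans <| by
    rw [div_le_one] <;> linarith [hμ.2]
  rw [Real.dist_0_eq_abs, abs_of_nonneg dist_nonneg, dist_comm, dist_eq_norm]
  refine hle.trans_lt ?_
  nlinarith

end MultiTask

theorem theorem1 {S C M R : ℕ} (G : SimpleGraph (Fin S)) (cluster : Fin S → Fin C)
    (A : Matrix (Fin S) (Fin S) ℝ) (hA : MultiTask.IsCombinationMatrix G cluster A)
    (prob : MultiTask.DecisionProblem M R) (π : Fin C → PMF (Fin M))
    (hπ : prob.IsStateOfNature π)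
    {Ω : Type*} [MeasurableSpace Ω] (P : Measure Ω) [IsProbabilityMeasure P]
    (x : Fin S → ℕ+ → Ω → Fin M)
    (hlaw : ∀ k i, HasLaw (x k i) (π (cluster k)).toMeasure P)
    (hindep : iIndepFun (fun s : Fin S × ℕ+ => x s.1 s.2) P)
    (k : Fin S) :
    -- the limit that defines `β_k(A)` exists, and `β_k(A)` satisfies the bounds
    (∀ μ ∈ Set.Ioo (0 : ℝ) 1, Summable (MultiTask.betaTerm A k μ)) ∧
    Tendsto (fun μ : ℝ => ∑' j : ℕ+, MultiTask.betaTerm A k μ j) (𝓝[>] 0)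
      (𝓝 (MultiTask.beta A k)) ∧
    1 / (2 * (S : ℝ)) ≤ MultiTask.beta A k ∧ MultiTask.beta A k ≤ 1 / 2 ∧
    -- convergence in distribution for `i → ∞` (to a steady-state law `ν μ`), then for `μ → 0⁺`
    ∃ ν : ℝ → ProbabilityMeasure (EuclideanSpace ℝ (Fin R)),
      (∀ μ ∈ Set.Ioo (0 : ℝ) 1,
        TendstoInDistribution (fun i : ℕ => MultiTask.centredRowSum P prob x A μ k i) atTop
          id (fun _ => P) (ν μ : Measure (EuclideanSpace ℝ (Fin R)))) ∧
      ∀ n : ℕ+,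
        TendstoInDistribution (fun _ : ℝ => (id : EuclideanSpace ℝ (Fin R) → _)) (𝓝[>] 0)
          id (fun μ => (ν μ : Measure (EuclideanSpace ℝ (Fin R))))
          (multivariateGaussian 0
            (MultiTask.beta A k • MultiTask.localCovariance P prob x k n)) := by
  have hS := hA.rightStochastic
  refine ⟨fun μ hμ => MultiTask.summable_betaTerm hS k hμ, MultiTask.tendsto_tsum_betaTerm hS k,
    MultiTask.one_div_le_beta hS k, MultiTask.beta_le_half hS k, ?_⟩
  have hex (μ : ℝ) : ∃ ν : ProbabilityMeasure (EuclideanSpace ℝ (Fin R)),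
      μ ∈ Set.Ioo (0 : ℝ) 1 →
        TendstoInDistribution (fun i : ℕ => MultiTask.centredRowSum P prob x A μ k i) atTop
          id (fun _ => P) (ν : Measure (EuclideanSpace ℝ (Fin R))) := by
    by_cases hμ : μ ∈ Set.Ioo (0 : ℝ) 1
    · obtain ⟨ν, hν⟩ :=
        MultiTask.exists_tendstoInDistribution_centredRowSum hA hlaw hindep prob hμ k
      exact ⟨ν, fun _ => hν⟩
    -- An arbitrary value: step sizes outside `(0, 1)` are eventually avoided as `μ → 0⁺`.
    · exact ⟨⟨Measure.dirac 0, inferInstance⟩, fun h => absurd h hμ⟩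
  choose ν hν using hex
  refine ⟨ν, hν, fun n => ⟨fun _ => aemeasurable_id, aemeasurable_id, ?_⟩⟩
  -- Lévy's continuity theorem is applied along each sequence of step sizes tending to `0⁺`.
  refine tendsto_of_seq_tendsto fun u hu => ProbabilityMeasure.tendsto_iff_tendsto_charFun.2
    fun t => ?_
  simp only [ProbabilityMeasure.coe_mk, Measure.map_id]
  rw [MultiTask.charFun_multivariateGaussian_beta hS hlaw]
  exact (MultiTask.tendsto_charFun_steadyState hA hlaw hindep prob k hν t).comp hu
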